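/- **Setting.** A spectral triple $(\mathcal{A},\mathcal{H},\mathcal{D})$ consists of a unital pre-$C^*$-algebra $\mathcal{A}$ (a dense unital $*$-subalgebra of a $C^*$-algebra, closed under holomorphic functional calculus), a separable complex Hilbert space $\mathcal{H}$ with bounded operators $L(\mathcal{H})$, a faithful unital $*$-representation $\pi:\mathcal{A}\to L(\mathcal{H})$, and a self-adjoint operator $\mathcal{D}$ on $\mathcal{H}$ such that $(\mathcal{D}-\lambda)^{-1}$ is compact for $\lambda\notin\mathbb{R}$ and such that, for all $a\in\mathcal{A}$, $\pi(a)$ maps $\operatorname{dom}\mathcal{D}$ into itself and $[\mathcal{D},\pi(a)]$ extends from $\operatorname{dom}\mathcal{D}$ to a bounded operator, again denoted $[\mathcal{D},\pi(a)]$. Put $|\mathcal{D}|=\sqrt{\mathcal{D}^2}$. For $w\in\mathbb{C}$ the operator $|\mathcal{D}|^{w}$ is defined by functional calculus on $(\ker\mathcal{D})^\perp$ and is $0$ on $\ker\mathcal{D}$. Let $\operatorname{dom}\delta$ be the set of $b\in L(\mathcal{H})$ that map $\operatorname{dom}|\mathcal{D}|$ into itself and for which $[|\mathcal{D}|,b]$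 extends from $\operatorname{dom}|\mathcal{D}|$ to a bounded operator; $\delta(b)$ denotes this extension. Assume: * **Dimension 3.** $n=3$ is the smallest positive integer $n$ such that the decreasing sequence $(\lambda_k)$ of eigenvalues of $|\mathcal{D}|^{-1}$ (with multiplicities) satisfies $\lambda_k=O(k^{-1/n})$. * **Regularity.** Every element of the algebra generated by $\pi(\mathcal{A})$ and $[\mathcal{D},\pi(\mathcal{A})]$ lies in $\operatorname{dom}(\delta^k)$ for all $k\in\mathbb{N}$. * **Discrete dimension spectrum.** Let $\mathcal{B}$ be the algebra generated by the elements $\delta^k(\pi(a))$ and $\delta^k([\mathcal{D},\pi(a)])$, $a\in\mathcal{A}$, $k\ge 0$. There is a closed discrete set $\Sigma\subset\mathbb{C}$ such that for every $b\in\mathcal{B}$ the function $\zeta_b(z)=\operatorname{Trace}(b|\mathcal{D}|^{-2z})$, $\operatorname{Re}z>3/2$, extends holomorphically to $\mathbb{C}\setminus\Sigma$. For $b\in L(\mathcal{H})$, $y\in\mathbb{C}$ and an integer $k\ge 0$ put $$\tau_k(b|\mathcal{D}|^{y})=\operatorname{Res}_{z=0}\,z^k\operatorname{Trace}(b|\mathcal{D}|^{y-2z}),$$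 whenever the trace exists for all $z$ with sufficiently large real part and, as a function of $z$, extends holomorphically to the complement of a closed discrete subset of $\mathbb{C}$; the residue is that of the extension. **Lemma 2.2.** Let $A$ and $B$ be operators each of which is of the form $\pi(a)$ or $[\mathcal{D},\pi(a)]$ with $a\in\mathcal{A}$. Then for every integer $k\ge 0$ the residues $\tau_k(AB|\mathcal{D}|^{-3})$ and $\tau_k(BA|\mathcal{D}|^{-3})$ exist, and $$\tau_k(AB|\mathcal{D}|^{-3})=\tau_k(BA|\mathcal{D}|^{-3}).$$ -/

import Mathlib

open Filter Topology Asymptotics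

noncomputable section

/-! ### Pre-C*-algebras -/

/-- `Φ` is the holomorphic functional calculus of `a` on the open set `U`: on the functions that
are holomorphic on `U` it is a unital algebra homomorphism, it sends the coordinate function to
`a`, and it is continuous for locally uniform convergence on `U`. (For open `U ⊇ spectrum a` there
is exactly one such `Φ`, given by the Cauchy integral.) -/
structure IsHolomorphicCalculus {A : Type*} [CStarAlgebra A] (a : A) (U : Set ℂ)
    (Φ : (ℂ → ℂ) → A) : Prop where
  map_const : ∀ c : ℂ, Φ (fun _ => c) = algebraMap ℂ A c
  map_id : Φ (fun z => z) = a
  map_add : ∀ f g : ℂ → ℂ, DifferentiableOn ℂ f U → DifferentiableOn ℂ g U →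
    Φ (fun z => f z + g z) = Φ f + Φ g
  map_mul : ∀ f g : ℂ → ℂ, DifferentiableOn ℂ f U → DifferentiableOn ℂ g U →
    Φ (fun z => f z * g z) = Φ f * Φ g
  continuous : ∀ (f : ℕ → ℂ → ℂ) (g : ℂ → ℂ), (∀ n, DifferentiableOn ℂ (f n) U) →
    DifferentiableOn ℂ g U → TendstoLocallyUniformlyOn f g atTop U →
    Tendsto (fun n => Φ (f n)) atTop (𝓝 (Φ g))

/-- A unital pre-C*-algebra: a dense unital *-subalgebra of a C*-algebra that is closed with
respect to holomorphic functional calculus. -/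
structure IsPreCStarAlgebra {A : Type*} [CStarAlgebra A] (𝒜 : StarSubalgebra ℂ A) : Prop where
  dense : Dense (𝒜 : Set A)
  holomorphic_closed : ∀ a ∈ 𝒜, ∀ U : Set ℂ, IsOpen U → spectrum ℂ a ⊆ U →
    ∀ Φ : (ℂ → ℂ) → A, IsHolomorphicCalculus a U Φ →
      ∀ f : ℂ → ℂ, DifferentiableOn ℂ f U → Φ f ∈ 𝒜

section Operators

variable {H : Type*} [NormedAddCommGroup H] [InnerProductSpace ℂ H]

/-! ### Unbounded operators -/

/-- The eigenspace `ker (T - μ)` of a (possibly unbounded) operator. -/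
def pmapEigenspace (T : H →ₗ.[ℂ] H) (μ : ℝ) : Submodule ℂ H where
  carrier := {x | ∃ h : x ∈ T.domain, T ⟨x, h⟩ = (μ : ℂ) • x}
  zero_mem' := ⟨T.domain.zero_mem, by
    have : (⟨0, T.domain.zero_mem⟩ : T.domain) = 0 := rfl
    rw [this]; simp⟩
  add_mem' := by
    rintro x y ⟨hx, ex⟩ ⟨hy, ey⟩
    refine ⟨T.domain.add_mem hx hy, ?_⟩
    have : (⟨x + y, T.domain.add_mem hx hy⟩ : T.domain) = ⟨x, hx⟩ + ⟨y, hy⟩ := rfl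
    rw [this, LinearPMap.map_add, ex, ey, smul_add]
  smul_mem' := by
    rintro c x ⟨hx, ex⟩
    refine ⟨T.domain.smul_mem c hx, ?_⟩
    have : (⟨c • x, T.domain.smul_mem c hx⟩ : T.domain) = c • ⟨x, hx⟩ := rfl
    rw [this, LinearPMap.map_smul, ex, smul_comm]

/-- `R` is the bounded, everywhere defined inverse of `T - z`. -/
def IsResolventAt (T : H →ₗ.[ℂ] H) (z : ℂ) (R : H →L[ℂ] H) : Prop :=
  (∀ x : H, ∃ h : R x ∈ T.domain, T ⟨R x, h⟩ - z • R x = x) ∧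
  (∀ x : T.domain, R (T x - z • (x : H)) = x)

/-- The bounded operator `a` maps `dom T` into itself and the commutator `[T, a] = T a - a T`,
defined on `dom T`, has the bounded extension `S` (unique if `dom T` is dense). -/
def IsCommutator (T : H →ₗ.[ℂ] H) (a S : H →L[ℂ] H) : Prop :=
  ∀ x : T.domain, ∃ h : a (x : H) ∈ T.domain, T ⟨a (x : H), h⟩ - a (T x) = S x

/-- `a` lies in the domain of the `k`-th power of the derivation `[T, ·]`, with value `S`. -/
def IsIteratedCommutator (T : H →ₗ.[ℂ] H) : ℕ → (H →L[ℂ] H) → (H →L[ℂ] H) → Prop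
  | 0, a, S => S = a
  | k + 1, a, S => ∃ R : H →L[ℂ] H, IsIteratedCommutator T k a R ∧ IsCommutator T R S

open scoped Classical in
/-- The bounded extension to all of `H` of a densely defined operator (`0` if there is none). -/
def boundedExtension (T : H →ₗ.[ℂ] H) : H →L[ℂ] H :=
  if h : ∃ S : H →L[ℂ] H, Dense (T.domain : Set H) ∧ ∀ x : T.domain, S x = T x
  then h.choose else 0

/-- `lam` lists the nonzero eigenvalues of a positive compact operator `T` in decreasing order,
each one as often as its multiplicity (followed by zeros if there are only finitely many). -/
def IsEigenvalueSequence (T : H →ₗ.[ℂ] H) (lam : ℕ → ℝ) : Prop :=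
  Antitone lam ∧ (∀ k, 0 ≤ lam k) ∧
    ∀ μ : ℝ, 0 < μ →
      Set.encard {k | lam k = μ} = Cardinal.toENat (Module.rank ℂ (pmapEigenspace T μ))

/-! ### The trace -/

/-- Trace class operators, as nuclear operators `x ↦ ∑ ⟨u n, x⟩ v n` with
`∑ ‖u n‖ ‖v n‖ < ∞`. -/
def IsTraceClass (T : H →L[ℂ] H) : Prop :=
  ∃ u v : ℕ → H, Summable (fun n => ‖u n‖ * ‖v n‖) ∧
    ∀ x : H, HasSum (fun n => inner ℂ (u n) x • v n) (T x)

variable [CompleteSpace H]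

open scoped Classical in
/-- The trace `∑ ⟨e i, T e i⟩` of a trace class operator, over some orthonormal basis
(for a trace class operator the choice does not matter); `0` if `T` is not trace class. -/
def opTrace (T : H →L[ℂ] H) : ℂ :=
  if IsTraceClass T then
    ∑' i : (exists_hilbertBasis ℂ H).choose, inner ℂ (i : H) (T (i : H)) else 0

/-! ### Functions of a self-adjoint operator with compact resolvent -/

/-- The orthogonal projection onto the eigenspace `ker (T - μ)`. (The eigenspaces of a self-adjoint
operator are closed already.) -/
def eigenprojection (T : H →ₗ.[ℂ] H) (μ : ℝ) : H →L[ℂ] H :=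
  (pmapEigenspace T μ).topologicalClosure.starProjection

/-- The operator `f(T) = ∑ f(μ) P_μ` (sum over the eigenvalues `μ` of `T`), for a self-adjoint
operator `T` with compact resolvent, so that `H` is the Hilbert sum of the eigenspaces of `T`. Its
domain consists of all `x` for which `∑ f(μ) P_μ x` converges unconditionally in norm; as the
summands are orthogonal this means `∑ |f(μ)|² ‖P_μ x‖² < ∞`. -/
def spectralFunction (T : H →ₗ.[ℂ] H) (f : ℝ → ℂ) : H →ₗ.[ℂ] H where
  domain :=
    { carrier := {x | Summable (fun μ : ℝ => f μ • eigenprojection T μ x)}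
      zero_mem' := by
        change Summable _
        simp [summable_zero]
      add_mem' := by
        intro x y hx hy
        change Summable _
        simpa only [map_add, smul_add] using Summable.add hx hy
      smul_mem' := by
        intro c x hx
        change Summable _
        simpa only [map_smul, smul_comm _ c] using Summable.const_smul c hx }
  toFun :=
    { toFun := fun x => ∑' μ : ℝ, f μ • eigenprojection T μ (x : H)
      map_add' := by
        intro x y
        simpa only [Submodule.coe_add, map_add, smul_add] using
          Summable.tsum_add (show Summable _ from x.2) (show Summable _ from y.2)
      map_smul' := by
        intro c x
        simpa only [Submodule.coe_smul, map_smul, smul_comm _ c, RingHom.id_apply] using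
          Summable.tsum_const_smul c (show Summable _ from x.2) }

/-- `|T| = √(T²)`. -/
def absOp (T : H →ₗ.[ℂ] H) : H →ₗ.[ℂ] H :=
  spectralFunction T (fun μ => ((|μ| : ℝ) : ℂ))

open scoped Classical in
/-- The power `|T| ^ w`, on the orthogonal complement of `ker T`, and `0` on `ker T`. -/
def absPow (T : H →ₗ.[ℂ] H) (w : ℂ) : H →ₗ.[ℂ] H :=
  spectralFunction T (fun μ => if μ = 0 then 0 else ((|μ| : ℝ) : ℂ) ^ w)

/-- The function `w ↦ b |T| ^ w`, for a bounded operator `b`; the composition is taken with the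
bounded extension of `|T| ^ w`, which exists for `Re w ≤ 0`. -/
def mulAbsPow (T : H →ₗ.[ℂ] H) (b : H →L[ℂ] H) (w : ℂ) : H →L[ℂ] H :=
  b * boundedExtension (absPow T w)

end Operators

/-! ### Spectral triples -/

/-- Spectral triples `(𝒜, H, D)`; `𝒜` is a pre-C*-algebra inside the C*-algebra `A`. -/
structure SpectralTriple (A : Type*) [CStarAlgebra A] (H : Type*) [NormedAddCommGroup H]
    [InnerProductSpace ℂ H] [CompleteSpace H] [TopologicalSpace.SeparableSpace H] where
  /-- the algebra -/
  𝒜 : StarSubalgebra ℂ A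
  preCStar : IsPreCStarAlgebra 𝒜
  /-- the representation -/
  π : 𝒜 →⋆ₐ[ℂ] (H →L[ℂ] H)
  faithful : Function.Injective π
  /-- the Dirac operator -/
  D : H →ₗ.[ℂ] H
  selfAdjoint : IsSelfAdjoint D
  bounded_commutators : ∀ a : 𝒜, ∃ C : H →L[ℂ] H, IsCommutator D (π a) C
  compact_resolvent : ∀ z : ℂ, z.im ≠ 0 →
    ∃ R : H →L[ℂ] H, IsResolventAt D z R ∧ IsCompactOperator R

namespace SpectralTriple

variable {A : Type*} [CStarAlgebra A] {H : Type*} [NormedAddCommGroup H]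
  [InnerProductSpace ℂ H] [CompleteSpace H] [TopologicalSpace.SeparableSpace H]

/-- The dimension of the spectral triple is `n`: it is the smallest positive integer such that
the decreasing sequence of eigenvalues of `|D|⁻¹` is `O(k ^ (-1/n))`. -/
def HasDimension (T : SpectralTriple A H) (n : ℕ) : Prop :=
  IsLeast {m : ℕ | 0 < m ∧ ∃ lam : ℕ → ℝ, IsEigenvalueSequence (absPow T.D (-1)) lam ∧
    lam =O[atTop] fun k : ℕ => (k : ℝ) ^ (-(1 : ℝ) / (m : ℝ))} n

/-- The bounded operators in `π(𝒜)` or `[D, π(𝒜)]`. -/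
def generators (T : SpectralTriple A H) : Set (H →L[ℂ] H) :=
  Set.range T.π ∪ {C | ∃ a : T.𝒜, IsCommutator T.D (T.π a) C}

/-- Regularity: every element of the algebra generated by `π(𝒜)` and `[D, π(𝒜)]` is in the domain
of all powers of the derivation `δ = [|D|, ·]`. -/
def IsRegular (T : SpectralTriple A H) : Prop :=
  ∀ b ∈ Algebra.adjoin ℂ T.generators, ∀ k : ℕ,
    ∃ S : H →L[ℂ] H, IsIteratedCommutator (absOp T.D) k b S

/-- The algebra `ℬ` generated by the `δ^k(π(a))` and `δ^k([D, π(a)])`. -/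
def algB (T : SpectralTriple A H) : Subalgebra ℂ (H →L[ℂ] H) :=
  Algebra.adjoin ℂ {S | ∃ b ∈ T.generators, ∃ k : ℕ, IsIteratedCommutator (absOp T.D) k b S}

/-- `ζ_b(z) = Trace (b |D| ^ (-2z))`. -/
def zeta (T : SpectralTriple A H) (b : H →L[ℂ] H) (z : ℂ) : ℂ :=
  opTrace (mulAbsPow T.D b (-2 * z))

/-- The triple (of dimension `p`) has discrete dimension spectrum: there is a (closed) discrete
subset `Σ` of `ℂ` such that all `ζ_b`, `b ∈ ℬ`, defined for `Re z > p / 2`, extend holomorphically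
to `ℂ \ Σ`. -/
def HasDiscreteDimensionSpectrum (T : SpectralTriple A H) (p : ℕ) : Prop :=
  ∃ S : Set ℂ, IsClosed S ∧ DiscreteTopology S ∧
    ∀ b ∈ T.algB, ∃ F : ℂ → ℂ, DifferentiableOn ℂ F Sᶜ ∧
      ∀ z : ℂ, (p : ℝ) / 2 < z.re → F z = T.zeta b z

/-- `c` is the residue at `z = 0` of `z ^ k * Trace (b |D| ^ (y - 2z))`. The trace exists for large
`Re z`; the residue is that of its holomorphic extension `F` to the complement of some closed
discrete set, which is `(2πi)⁻¹` times the integral over small circles around `0`. -/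
def HasTau (T : SpectralTriple A H) (k : ℕ) (b : H →L[ℂ] H) (y : ℂ) (c : ℂ) : Prop :=
  ∃ (S : Set ℂ) (F : ℂ → ℂ), IsClosed S ∧ DiscreteTopology S ∧ DifferentiableOn ℂ F Sᶜ ∧
    (∃ x₀ : ℝ, ∀ z : ℂ, x₀ < z.re → IsTraceClass (mulAbsPow T.D b (y - 2 * z)) ∧
      F z = opTrace (mulAbsPow T.D b (y - 2 * z))) ∧
    ∀ᶠ r : ℝ in 𝓝[>] 0,
      (2 * Real.pi * Complex.I : ℂ)⁻¹ * (∮ z in C(0, r), z ^ k * F z) = c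

open scoped Classical in
/-- `τ_k(b |D| ^ y) = Res_{z=0} z ^ k Trace (b |D| ^ (y - 2z))` (`0` if there is no such residue;
there is at most one). -/
def tau (T : SpectralTriple A H) (k : ℕ) (b : H →L[ℂ] H) (y : ℂ) : ℂ :=
  if h : ∃ c : ℂ, T.HasTau k b y c then h.choose else 0

end SpectralTriple

end

noncomputable section

/-! Choose an orthonormal basis `e i` of eigenvectors of `D`, with eigenvalues `m i`. Write X_ij for
the matrix entries of a bounded operator X. For large Re s, expanding both traces gives
Tr(AB|D|^(-s)) - Tr(BA|D|^(-s)) = ∑_{i,j} (|m i|^(-s) - |m j|^(-s)) A_ij B_ji. By the mean value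
inequality the bracket is at most a constant times ||m i| - |m j|| (|m i|^(-Re s-1) + |m j|^(-Re
s-1)). The factor ||m i| - |m j|| turns B_ji into an entry of the bounded operator [|D|, B], and one
power of |D| has been gained. So the double sum is holomorphic for Re s > n - 1, a half-plane that
contains the point s = n where the residues are taken (`norm_nonzeroAbsPow_sub_le`,
`differentiableOn_commutatorTrace`).

The two continued traces therefore differ near z = 0 by a holomorphic function, and z^k times it has
no residue there. The identity theorem carries the difference from the region of convergence to 0;
it applies because a half-plane minus a countable set is connected
(`eventually_circleIntegral_eq_of_sub_eq`). The residues exist because AB and BA lie in `algB` and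
the functions in question are translates of ζ_AB and ζ_BA. -/

lemma Orthonormal.countable {𝕜 E ι : Type*} [RCLike 𝕜] [NormedAddCommGroup E]
    [InnerProductSpace 𝕜 E] [TopologicalSpace.SeparableSpace E] {v : ι → E}
    (hv : Orthonormal 𝕜 v) : Countable ι := by
  have hdist : ∀ i j, i ≠ j → 1 ≤ dist (v i) (v j) := by
    intro i j hij
    have h : ‖v i - v j‖ ^ 2 = 2 := by
      rw [@norm_sub_sq 𝕜, hv.1 i, hv.1 j, hv.2 hij]
      norm_num
    rw [dist_eq_norm]
    nlinarith [norm_nonneg (v i - v j)]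
  -- Distinct members are √2 apart, so these balls are disjoint open sets in a separable space.
  refine Pairwise.countable_of_isOpen_disjoint (s := fun i => Metric.ball (v i) (1 / 2))
    (fun i j hij => Metric.ball_disjoint_ball ?_) (fun i => Metric.isOpen_ball)
    (fun i => ⟨v i, Metric.mem_ball_self (by norm_num)⟩)
  linarith [hdist i j hij]

/-! ### Eigenbasis of a self-adjoint operator with compact resolvent -/

section SpectralTheorem

variable {H : Type*} [NormedAddCommGroup H] [InnerProductSpace ℂ H]

lemma IsResolventAt.injective {D : H →ₗ.[ℂ] H} {z : ℂ} {R : H →L[ℂ] H}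
    (hR : IsResolventAt D z R) {x : H} (hx : R x = 0) : x = 0 := by
  obtain ⟨h, e⟩ := hR.1 x
  have : (⟨R x, h⟩ : D.domain) = 0 := Subtype.ext hx
  rw [this, hx] at e
  simpa using e.symm

lemma IsResolventAt.mem_domain {D : H →ₗ.[ℂ] H} {z : ℂ} {R : H →L[ℂ] H}
    (hR : IsResolventAt D z R) (x : H) : R x ∈ D.domain := (hR.1 x).1

lemma IsResolventAt.apply {D : H →ₗ.[ℂ] H} {z : ℂ} {R : H →L[ℂ] H}
    (hR : IsResolventAt D z R) (x : H) : D ⟨R x, hR.mem_domain x⟩ = x + z • R x :=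
  eq_add_of_sub_eq (hR.1 x).2

lemma IsResolventAt.comm {D : H →ₗ.[ℂ] H} {z : ℂ} {R : H →L[ℂ] H}
    (hR : IsResolventAt D z R) (x : D.domain) :
    D ⟨R x, hR.mem_domain x⟩ = R (D x) := by
  have h := hR.2 x
  rw [map_sub, map_smul] at h
  rw [hR.apply, eq_add_of_sub_eq h]

variable [CompleteSpace H]

lemma inner_apply_eq_of_isSelfAdjoint {D : H →ₗ.[ℂ] H} (hD : IsSelfAdjoint D) (x y : D.domain) :
    inner ℂ (D x) (y : H) = inner ℂ (x : H) (D y) := by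
  have h := LinearPMap.adjoint_isFormalAdjoint hD.dense_domain
  rw [LinearPMap.isSelfAdjoint_def.mp hD] at h
  exact h x y

lemma inner_resolvent_conj {D : H →ₗ.[ℂ] H} (hD : IsSelfAdjoint D) {z w : ℂ}
    (hzw : w = (starRingEnd ℂ) z)
    {R S : H →L[ℂ] H} (hR : IsResolventAt D z R) (hS : IsResolventAt D w S) (x y : H) :
    inner ℂ (R x) y = inner ℂ x (S y) := by
  have h := inner_apply_eq_of_isSelfAdjoint hD ⟨R x, hR.mem_domain x⟩ ⟨S y, hS.mem_domain y⟩
  subst hzw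
  rw [hR.apply, hS.apply, inner_add_left, inner_add_right, inner_smul_left, inner_smul_right] at h
  exact (add_right_cancel h).symm

lemma inner_eq_zero_of_mem_pmapEigenspace {D : H →ₗ.[ℂ] H} (hD : IsSelfAdjoint D) {μ ν : ℝ}
    (hμν : μ ≠ ν) {x y : H} (hx : x ∈ pmapEigenspace D μ) (hy : y ∈ pmapEigenspace D ν) :
    inner ℂ x y = 0 := by
  obtain ⟨hx, ex⟩ := hx
  obtain ⟨hy, ey⟩ := hy
  have h := inner_apply_eq_of_isSelfAdjoint hD ⟨x, hx⟩ ⟨y, hy⟩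
  rw [ex, ey, inner_smul_left, inner_smul_right, Complex.conj_ofReal, ← sub_eq_zero,
    ← sub_mul] at h
  refine (mul_eq_zero.mp h).resolve_left ?_
  exact sub_ne_zero.mpr (by exact_mod_cast hμν)

/-- A self-adjoint operator with compact resolvent has an orthonormal basis of eigenvectors. -/
theorem exists_hilbertBasis_eigenvectors [TopologicalSpace.SeparableSpace H] {D : H →ₗ.[ℂ] H}
    (hD : IsSelfAdjoint D) (hc : ∀ z : ℂ, z.im ≠ 0 →
      ∃ R : H →L[ℂ] H, IsResolventAt D z R ∧ IsCompactOperator R) :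
    ∃ (ι : Type) (_ : Countable ι) (e : HilbertBasis ι ℂ H) (m : ι → ℝ),
      ∀ i, e i ∈ pmapEigenspace D (m i) := by
  obtain ⟨R, hR, hRc⟩ := hc Complex.I (by simp)
  obtain ⟨S, hS, -⟩ := hc (-Complex.I) (by simp)
  -- K = (D² + 1)⁻¹ is compact, symmetric and injective and commutes with D. The spectral theorem
  -- for compact operators splits H into eigenspaces of K, and D is then diagonalised on each of
  -- them.
  set K : H →L[ℂ] H := R * S with hK
  have hKx : ∀ x, K x = R (S x) := fun x => rfl
  have hKc : IsCompactOperator K := hRc.comp_clm S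
  have hsymm : (K : H →ₗ[ℂ] H).IsSymmetric := by
    intro x y
    change inner ℂ (R (S x)) y = inner ℂ x (R (S y))
    rw [inner_resolvent_conj hD (by simp) hR hS, ← inner_resolvent_conj hD (by simp) hS hR]
  have hinj : ∀ x, K x = 0 → x = 0 := fun x hx => hS.injective (hR.injective hx)
  have hKd : ∀ x, K x ∈ D.domain := fun x => hR.mem_domain _
  have hKD : ∀ x : D.domain, D ⟨K x, hKd x⟩ = K (D x) := fun x => by
    have h := hR.comm ⟨S x, hS.mem_domain _⟩
    rw [hS.comm] at h
    exact h
  let E : ℂ → Submodule ℂ H := fun κ => Module.End.eigenspace (K : Module.End ℂ H) κ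
  have hE : ∀ κ x, x ∈ E κ ↔ K x = κ • x := fun κ x => Module.End.mem_eigenspace_iff
  have hE0 : E 0 = ⊥ := by
    rw [eq_bot_iff]
    intro x hx
    rw [hE, zero_smul] at hx
    exact hinj x hx
  have hfin : ∀ κ, FiniteDimensional ℂ (E κ) := by
    intro κ
    rcases eq_or_ne κ 0 with rfl | hκ
    · rw [hE0]; infer_instance
    · exact ContinuousLinearMap.finite_dimensional_eigenspace hKc κ hκ
  have hdom : ∀ κ, ∀ x ∈ E κ, x ∈ D.domain := by
    intro κ x hx
    rcases eq_or_ne κ 0 with rfl | hκ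
    · rw [hE0, Submodule.mem_bot] at hx
      rw [hx]; exact D.domain.zero_mem
    · rw [hE] at hx
      have : x = κ⁻¹ • K x := by rw [hx, smul_smul, inv_mul_cancel₀ hκ, one_smul]
      rw [this]
      exact D.domain.smul_mem _ (hKd x)
  have hinv : ∀ κ, ∀ x (hx : x ∈ E κ), D ⟨x, hdom κ x hx⟩ ∈ E κ := by
    intro κ x hx
    rw [hE, ← hKD ⟨x, hdom κ x hx⟩, ← LinearPMap.map_smul]
    congr 1
    exact Subtype.ext ((hE κ x).mp hx)
  -- The restriction of D to an eigenspace of K is a symmetric map of a finite-dimensional space.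
  let T : ∀ κ, E κ →ₗ[ℂ] E κ := fun κ =>
    { toFun := fun x => ⟨D ⟨x, hdom κ x x.2⟩, hinv κ x x.2⟩
      map_add' := fun x y => Subtype.ext
        (LinearPMap.map_add D ⟨x, hdom κ x x.2⟩ ⟨y, hdom κ y y.2⟩)
      map_smul' := fun c x => Subtype.ext (LinearPMap.map_smul D c ⟨x, hdom κ x x.2⟩) }
  have hT : ∀ κ, (T κ).IsSymmetric := fun κ x y =>
    inner_apply_eq_of_isSelfAdjoint hD ⟨x, hdom κ x x.2⟩ ⟨y, hdom κ y y.2⟩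
  let ι := Σ κ : ℂ, Fin (Module.finrank ℂ (E κ))
  let b : ∀ κ, OrthonormalBasis (Fin (Module.finrank ℂ (E κ))) ℂ (E κ) := fun κ =>
    (hT κ).eigenvectorBasis rfl
  let v : ι → H := fun i => (b i.1 i.2 : H)
  have hv : Orthonormal ℂ v :=
    (hsymm.orthogonalFamily_eigenspaces).orthonormal_sigma_orthonormal
      (v_family := fun κ => ⇑(b κ)) (fun κ => (b κ).orthonormal)
  have hspan : (Submodule.span ℂ (Set.range v))ᗮ = ⊥ := by
    rw [eq_bot_iff, ← ContinuousLinearMap.orthogonalComplement_iSup_eigenspaces_eq_bot hKc hsymm]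
    apply Submodule.orthogonal_le
    apply iSup_le
    intro κ x hx
    have h1 : (⟨x, hx⟩ : E κ) ∈ Submodule.span ℂ (Set.range (b κ)) := by
      rw [← OrthonormalBasis.coe_toBasis, (b κ).toBasis.span_eq]; trivial
    have h2 := Submodule.mem_map_of_mem (f := (E κ).subtype) h1
    rw [Submodule.map_span] at h2
    refine Submodule.span_mono ?_ h2
    rintro _ ⟨_, ⟨j, rfl⟩, rfl⟩
    exact ⟨⟨κ, j⟩, rfl⟩
  refine ⟨ι, hv.countable, HilbertBasis.mkOfOrthogonalEqBot hv hspan,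
    fun i => (hT i.1).eigenvalues rfl i.2, fun i => ?_⟩
  rw [HilbertBasis.coe_mkOfOrthogonalEqBot]
  refine ⟨hdom i.1 _ (b i.1 i.2).2, ?_⟩
  exact congrArg Subtype.val ((hT i.1).apply_eigenvectorBasis rfl i.2)

end SpectralTheorem

/-! ### Diagonal operators and their traces -/

section DiagonalOperators

variable {H : Type*} [NormedAddCommGroup H] [InnerProductSpace ℂ H]

/-- Cauchy–Schwarz, followed by Bessel's inequality for x and for y. -/
lemma Orthonormal.sum_norm_inner_mul_norm_inner_le {ι : Type*} {v : ι → H} (hv : Orthonormal ℂ v)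
    (x y : H) (s : Finset ι) :
    ∑ i ∈ s, ‖inner ℂ x (v i)‖ * ‖inner ℂ (v i) y‖ ≤ ‖x‖ * ‖y‖ := by
  have hs : ∀ z : H, √(∑ i ∈ s, ‖inner ℂ (v i) z‖ ^ 2) ≤ ‖z‖ := fun z =>
    Real.sqrt_le_iff.mpr ⟨norm_nonneg _, hv.sum_inner_products_le z⟩
  calc ∑ i ∈ s, ‖inner ℂ x (v i)‖ * ‖inner ℂ (v i) y‖
      = ∑ i ∈ s, ‖inner ℂ (v i) x‖ * ‖inner ℂ (v i) y‖ := by simp_rw [norm_inner_symm x]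
    _ ≤ √(∑ i ∈ s, ‖inner ℂ (v i) x‖ ^ 2) * √(∑ i ∈ s, ‖inner ℂ (v i) y‖ ^ 2) :=
        Real.sum_mul_le_sqrt_mul_sqrt _ _ _
    _ ≤ ‖x‖ * ‖y‖ := mul_le_mul (hs x) (hs y) (Real.sqrt_nonneg _) (norm_nonneg _)

lemma Orthonormal.summable_norm_inner_mul_norm_inner {ι : Type*} {v : ι → H}
    (hv : Orthonormal ℂ v) (x y : H) :
    Summable fun i => ‖inner ℂ x (v i)‖ * ‖inner ℂ (v i) y‖ :=
  summable_of_sum_le (fun _ => by positivity) (hv.sum_norm_inner_mul_norm_inner_le x y)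

lemma Orthonormal.tsum_norm_inner_mul_norm_inner_le {ι : Type*} {v : ι → H}
    (hv : Orthonormal ℂ v) (x y : H) :
    ∑' i, ‖inner ℂ x (v i)‖ * ‖inner ℂ (v i) y‖ ≤ ‖x‖ * ‖y‖ :=
  (hv.summable_norm_inner_mul_norm_inner x y).tsum_le_of_sum_le
    (hv.sum_norm_inner_mul_norm_inner_le x y)

lemma HilbertBasis.norm_eq_one {ι : Type*} (e : HilbertBasis ι ℂ H) (i : ι) : ‖e i‖ = 1 :=
  e.orthonormal.1 i

lemma HilbertBasis.eq_of_inner_eq {ι : Type*} (e : HilbertBasis ι ℂ H) {x y : H}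
    (h : ∀ i, inner ℂ (e i) x = inner ℂ (e i) y) : x = y := by
  apply e.repr.injective
  ext i
  rw [e.repr_apply_apply, e.repr_apply_apply, h]

lemma summable_prod_mul_of_tsum_le {ι κ : Type*} {a : ι → ℝ} {G : ι → κ → ℝ} (ha : Summable a)
    (ha0 : ∀ i, 0 ≤ a i) (hG0 : ∀ i j, 0 ≤ G i j) (hG : ∀ i, Summable (G i)) {C : ℝ}
    (hC : ∀ i, ∑' j, G i j ≤ C) : Summable fun p : ι × κ => a p.1 * G p.1 p.2 := by
  have h0 : ∀ i j, 0 ≤ a i * G i j := fun i j => mul_nonneg (ha0 i) (hG0 i j)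
  have h1 : (0 : ι × κ → ℝ) ≤ fun p => a p.1 * G p.1 p.2 := fun p => h0 p.1 p.2
  have h2 : ∀ i, ∑' j, a i * G i j = a i * ∑' j, G i j := fun i => tsum_mul_left
  refine (summable_prod_of_nonneg h1).mpr ⟨fun i => (hG i).mul_left (a i), ?_⟩
  refine Summable.of_nonneg_of_le (fun i => tsum_nonneg (h0 i)) (fun i => ?_) (ha.mul_right C)
  refine (h2 i).trans_le ?_
  exact mul_le_mul_of_nonneg_left (hC i) (ha0 i)

/-- If the weights `a i` are summable and the `x i`, `y i` are bounded, then the coefficients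
`⟪x i, v j⟫⟪v j, y i⟫` over an orthonormal system `v` are absolutely summable with these
weights. -/
lemma summable_prod_norm_inner {ι κ : Type*} {v : κ → H} (hv : Orthonormal ℂ v)
    {a : ι → ℝ} (ha : Summable a) (ha0 : ∀ i, 0 ≤ a i) (x y : ι → H) {C : ℝ}
    (hC : ∀ i, ‖x i‖ * ‖y i‖ ≤ C) :
    Summable fun p : ι × κ =>
      a p.1 * (‖inner ℂ (x p.1) (v p.2)‖ * ‖inner ℂ (v p.2) (y p.1)‖) :=
  summable_prod_mul_of_tsum_le (G := fun i j => ‖inner ℂ (x i) (v j)‖ * ‖inner ℂ (v j) (y i)‖)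
    ha ha0 (fun _ _ => by positivity)
    (fun i => hv.summable_norm_inner_mul_norm_inner (x i) (y i))
    (fun i => (hv.tsum_norm_inner_mul_norm_inner_le (x i) (y i)).trans (hC i))

variable [CompleteSpace H]

/-- The operator that is diagonal in the basis `e`, with absolutely summable diagonal `c`. -/
def diagOp {ι : Type*} (e : HilbertBasis ι ℂ H) (c : ι → ℂ) : H →L[ℂ] H :=
  ∑' i, c i • InnerProductSpace.rankOne ℂ (e i) (e i)

lemma hasSum_diagOp_apply {ι : Type*} (e : HilbertBasis ι ℂ H) {c : ι → ℂ}
    (hc : Summable fun i => ‖c i‖) (x : H) :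
    HasSum (fun i => c i • (inner ℂ (e i) x • e i)) (diagOp e c x) := by
  have h : Summable fun i => c i • InnerProductSpace.rankOne ℂ (e i) (e i) := by
    refine Summable.of_norm ?_
    simpa [norm_smul, e.norm_eq_one] using hc
  simpa [diagOp] using h.hasSum.mapL (ContinuousLinearMap.apply ℂ H x)

lemma inner_diagOp_apply {ι : Type*} (e : HilbertBasis ι ℂ H) {c : ι → ℂ}
    (hc : Summable fun i => ‖c i‖) (i : ι) (x : H) :
    inner ℂ (e i) (diagOp e c x) = c i * inner ℂ (e i) x := by
  classical
  have h := (hasSum_diagOp_apply e hc x).mapL (innerSL ℂ (e i))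
  refine h.unique ?_
  convert! hasSum_single (f := fun j => innerSL ℂ (e i) (c j • (inner ℂ (e j) x • e j))) i ?_ using 1
  · simp [e.norm_eq_one]
  · intro j hj
    simp [e.orthonormal.2 hj.symm]

lemma isTraceClass_mul_diagOp {ι : Type*} [Countable ι] (e : HilbertBasis ι ℂ H) {c : ι → ℂ}
    (hc : Summable fun i => ‖c i‖) (b : H →L[ℂ] H) : IsTraceClass (b * diagOp e c) := by
  -- The nuclear representation is ∑ ⟨e i, ·⟩ c i • b (e i). As `IsTraceClass` asks for sequences,
  -- the family is moved to ℕ along an injection and extended by zero.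
  obtain ⟨g, hg⟩ := exists_injective_nat ι
  refine ⟨Function.extend g e 0, Function.extend g (fun i => c i • b (e i)) 0, ?_, fun x => ?_⟩
  · have : (fun n => ‖Function.extend g e 0 n‖ * ‖Function.extend g (fun i => c i • b (e i)) 0 n‖)
        = Function.extend g (fun i => ‖e i‖ * ‖c i • b (e i)‖) 0 := by
      ext n
      by_cases h : ∃ i, g i = n
      · obtain ⟨i, rfl⟩ := h
        simp [hg.extend_apply]
      · simp [Function.extend_apply' _ _ _ h]
    rw [this, summable_extend_zero hg]
    refine Summable.of_nonneg_of_le (fun i => by positivity) (fun i => ?_) (hc.mul_right ‖b‖)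
    rw [e.norm_eq_one, one_mul, norm_smul]
    gcongr
    simpa [e.norm_eq_one] using b.le_opNorm (e i)
  · have : (fun n => inner ℂ (Function.extend g e 0 n) x •
          Function.extend g (fun i => c i • b (e i)) 0 n)
        = Function.extend g (fun i => inner ℂ (e i) x • (c i • b (e i))) 0 := by
      ext n
      by_cases h : ∃ i, g i = n
      · obtain ⟨i, rfl⟩ := h
        simp [hg.extend_apply]
      · simp [Function.extend_apply' _ _ _ h]
    rw [this, hasSum_extend_zero hg]
    have h := (hasSum_diagOp_apply e hc x).mapL b
    simp only [map_smul, smul_comm (c _)] at h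
    exact h

/-- `opTrace` is computed in an unspecified basis d. Expanding through e gives an absolutely
convergent double sum, and exchanging the summations moves the trace to e by Parseval. -/
lemma opTrace_mul_diagOp {ι : Type*} [Countable ι] (e : HilbertBasis ι ℂ H) {c : ι → ℂ}
    (hc : Summable fun i => ‖c i‖) (b : H →L[ℂ] H) :
    opTrace (b * diagOp e c) = ∑' i, c i * inner ℂ (e i) (b (e i)) := by
  rw [opTrace, if_pos (isTraceClass_mul_diagOp e hc b)]
  obtain ⟨d, hd⟩ := (exists_hilbertBasis ℂ H).choose_spec
  have h1 : ∀ j, inner ℂ (d j) ((b * diagOp e c) (d j)) =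
      ∑' i, c i * (inner ℂ (e i) (d j) * inner ℂ (d j) (b (e i))) := fun j => by
    have := ((hasSum_diagOp_apply e hc (d j)).mapL b).mapL (innerSL ℂ (d j))
    simpa [inner_smul_right] using this.tsum_eq.symm
  have h2 : ∀ i, c i * inner ℂ (e i) (b (e i)) =
      ∑' j, c i * (inner ℂ (e i) (d j) * inner ℂ (d j) (b (e i))) := fun i => by
    rw [tsum_mul_left, d.tsum_inner_mul_inner]
  have hs : Summable (Function.uncurry fun i j =>
      c i * (inner ℂ (e i) (d j) * inner ℂ (d j) (b (e i)))) := by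
    refine Summable.of_norm ?_
    have := summable_prod_norm_inner d.orthonormal hc (fun _ => norm_nonneg _)
      (fun i => e i) (fun i => b (e i)) (C := ‖b‖) (fun i => by
        simpa [e.norm_eq_one] using b.le_opNorm (e i))
    simpa [Function.uncurry_def, norm_mul] using this
  rw [tsum_congr h2, ← hs.tsum_comm]
  refine tsum_congr fun j => ?_
  rw [← h1, hd]

end DiagonalOperators

/-! ### Functions of D in an eigenbasis -/

section SpectralFunction

variable {H : Type*} [NormedAddCommGroup H] [InnerProductSpace ℂ H] [CompleteSpace H]
  {D : H →ₗ.[ℂ] H} {ι : Type*} {e : HilbertBasis ι ℂ H} {m : ι → ℝ}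

open scoped Classical in
lemma eigenprojection_apply_of_mem (hD : IsSelfAdjoint D) {μ ν : ℝ} {x : H}
    (hx : x ∈ pmapEigenspace D ν) : eigenprojection D μ x = if μ = ν then x else 0 := by
  unfold eigenprojection
  split_ifs with h
  · subst h
    exact Submodule.starProjection_eq_self_iff.mpr (Submodule.le_topologicalClosure _ hx)
  · rw [Submodule.starProjection_apply_eq_zero_iff, Submodule.orthogonal_closure]
    intro y hy
    exact inner_eq_zero_of_mem_pmapEigenspace hD h hy hx

lemma hasSum_spectralFunction_of_mem (hD : IsSelfAdjoint D) (f : ℝ → ℂ) {ν : ℝ} {x : H}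
    (hx : x ∈ pmapEigenspace D ν) :
    HasSum (fun μ => f μ • eigenprojection D μ x) (f ν • x) := by
  classical
  simp_rw [eigenprojection_apply_of_mem hD hx]
  convert! hasSum_single (f := fun μ => f μ • if μ = ν then x else 0) ν ?_ using 1
  · simp
  · intro μ hμ
    simp [hμ]

lemma mem_domain_spectralFunction_of_mem (hD : IsSelfAdjoint D) (f : ℝ → ℂ) {ν : ℝ} {x : H}
    (hx : x ∈ pmapEigenspace D ν) : x ∈ (spectralFunction D f).domain :=
  (hasSum_spectralFunction_of_mem hD f hx).summable

lemma spectralFunction_apply_of_mem (hD : IsSelfAdjoint D) (f : ℝ → ℂ) {ν : ℝ} {x : H}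
    (hx : x ∈ pmapEigenspace D ν) :
    spectralFunction D f ⟨x, mem_domain_spectralFunction_of_mem hD f hx⟩ = f ν • x :=
  (hasSum_spectralFunction_of_mem hD f hx).tsum_eq

/-- The eigenprojections are self-adjoint, so each can be moved onto x, where only the one for ν
survives. -/
lemma inner_spectralFunction_apply (hD : IsSelfAdjoint D) (f : ℝ → ℂ) {ν : ℝ} {x : H}
    (hx : x ∈ pmapEigenspace D ν) (y : (spectralFunction D f).domain) :
    inner ℂ x (spectralFunction D f y) = f ν * inner ℂ x (y : H) := by
  classical
  have hy : Summable fun μ => f μ • eigenprojection D μ (y : H) := y.2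
  have h := hy.hasSum.mapL (innerSL ℂ x)
  refine h.unique ?_
  have hin : ∀ μ, innerSL ℂ x (f μ • eigenprojection D μ (y : H)) =
      f μ * inner ℂ (if μ = ν then x else 0) (y : H) := fun μ => by
    rw [← eigenprojection_apply_of_mem hD hx, innerSL_apply_apply, inner_smul_right]
    unfold eigenprojection
    rw [Submodule.inner_starProjection_left_eq_right]
  simp_rw [hin]
  convert! hasSum_single (f := fun μ => f μ * inner ℂ (if μ = ν then x else 0) (y : H)) ν ?_ using 1
  · simp
  · intro μ hμ
    simp [hμ]

lemma dense_domain_spectralFunction (hD : IsSelfAdjoint D)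
    (he : ∀ i, e i ∈ pmapEigenspace D (m i)) (f : ℝ → ℂ) :
    Dense ((spectralFunction D f).domain : Set H) := by
  have h : Submodule.span ℂ (Set.range e) ≤ (spectralFunction D f).domain := by
    rw [Submodule.span_le]
    rintro _ ⟨i, rfl⟩
    exact mem_domain_spectralFunction_of_mem hD f (he i)
  refine Dense.mono h ?_
  rw [Submodule.dense_iff_topologicalClosure_eq_top]
  exact e.dense_span

/-- Both operators have the same coefficients against every `e i`, hence agree on the dense domain;
continuity does the rest. -/
lemma boundedExtension_spectralFunction (hD : IsSelfAdjoint D)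
    (he : ∀ i, e i ∈ pmapEigenspace D (m i)) {f : ℝ → ℂ} (hf : Summable fun i => ‖f (m i)‖) :
    boundedExtension (spectralFunction D f) = diagOp e fun i => f (m i) := by
  have hS : ∀ x : (spectralFunction D f).domain,
      diagOp e (fun i => f (m i)) x = spectralFunction D f x := fun x =>
    e.eq_of_inner_eq fun i => by
      rw [inner_diagOp_apply e hf, inner_spectralFunction_apply hD f (he i)]
  have hd := dense_domain_spectralFunction hD he f
  have hex : ∃ S : H →L[ℂ] H, Dense ((spectralFunction D f).domain : Set H) ∧
      ∀ x : (spectralFunction D f).domain, S x = spectralFunction D f x := ⟨_, hd, hS⟩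
  rw [boundedExtension, dif_pos hex]
  refine ContinuousLinearMap.ext fun x => ?_
  refine congrFun (Continuous.ext_on hd hex.choose.continuous
    (diagOp e fun i => f (m i)).continuous fun y hy => ?_) x
  exact (hex.choose_spec.2 ⟨y, hy⟩).trans (hS ⟨y, hy⟩).symm

end SpectralFunction

/-! ### Estimates for complex powers of |μ| -/

section NonzeroAbsPow

open scoped Classical in
/-- The function `μ ↦ |μ| ^ w`, extended by `0` to `μ = 0`. -/
def nonzeroAbsPow (w : ℂ) (μ : ℝ) : ℂ := if μ = 0 then 0 else ((|μ| : ℝ) : ℂ) ^ w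

lemma nonzeroAbsPow_zero (w : ℂ) : nonzeroAbsPow w 0 = 0 := if_pos rfl

lemma nonzeroAbsPow_of_ne {μ : ℝ} (hμ : μ ≠ 0) (w : ℂ) :
    nonzeroAbsPow w μ = ((|μ| : ℝ) : ℂ) ^ w := if_neg hμ

lemma norm_nonzeroAbsPow_of_ne {μ : ℝ} (hμ : μ ≠ 0) (w : ℂ) :
    ‖nonzeroAbsPow w μ‖ = |μ| ^ w.re := by
  rw [nonzeroAbsPow_of_ne hμ, Complex.norm_cpow_eq_rpow_re_of_pos (abs_pos.mpr hμ)]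

/-- The exponent u wins for |μ| ≤ 1 and v wins for |μ| ≥ 1. This gives one majorant for all
exponents in a vertical strip. -/
lemma norm_nonzeroAbsPow_le_add {u v w : ℂ} (hu : u.re ≤ w.re) (hv : w.re ≤ v.re) (μ : ℝ) :
    ‖nonzeroAbsPow w μ‖ ≤ ‖nonzeroAbsPow u μ‖ + ‖nonzeroAbsPow v μ‖ := by
  rcases eq_or_ne μ 0 with rfl | hμ
  · simp [nonzeroAbsPow_zero]
  have hp := abs_pos.mpr hμ
  simp only [norm_nonzeroAbsPow_of_ne hμ]
  rcases le_total |μ| 1 with h | h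
  · exact (Real.rpow_le_rpow_of_exponent_ge hp h hu).trans
      (le_add_of_nonneg_right (Real.rpow_nonneg hp.le _))
  · exact (Real.rpow_le_rpow_of_exponent_le h hv).trans
      (le_add_of_nonneg_left (Real.rpow_nonneg hp.le _))

lemma differentiable_nonzeroAbsPow (μ : ℝ) : Differentiable ℂ fun w => nonzeroAbsPow w μ := by
  rcases eq_or_ne μ 0 with rfl | hμ
  · simp [nonzeroAbsPow_zero]
  · simp only [nonzeroAbsPow_of_ne hμ]
    intro w
    exact differentiableAt_id.const_cpow (Or.inl (by simpa using hμ))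

/-- Mean value inequality on [x, y]: the derivative of t^(-s) has norm ‖s‖ t^(-Re s - 1), which is
largest at t = x. -/
lemma norm_ofReal_cpow_neg_sub_le_of_le {s : ℂ} (hs : 0 ≤ s.re) {x y : ℝ} (hx : 0 < x)
    (hxy : x ≤ y) :
    ‖(y : ℂ) ^ (-s) - (x : ℂ) ^ (-s)‖ ≤ ‖s‖ * x ^ (-s - 1).re * (y - x) := by
  have h := (convex_Icc x y).norm_image_sub_le_of_norm_hasDerivWithin_le
    (f := fun t : ℝ => (t : ℂ) ^ (-s)) (f' := fun t : ℝ => -s * (t : ℂ) ^ (-s - 1))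
    (C := ‖s‖ * x ^ (-s - 1).re) (x := x) (y := y) (fun t ht => ?_) (fun t ht => ?_)
    (Set.left_mem_Icc.mpr hxy) (Set.right_mem_Icc.mpr hxy)
  · rwa [Real.norm_of_nonneg (sub_nonneg.mpr hxy)] at h
  · have h := ((hasDerivAt_id (t : ℂ)).cpow_const (c := -s)
      (Or.inl (by simpa using hx.trans_le ht.1))).comp_ofReal
    simpa using h.hasDerivWithinAt
  · rw [norm_mul, norm_neg, Complex.norm_cpow_eq_rpow_re_of_pos (hx.trans_le ht.1)]
    gcongr ‖s‖ * ?_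
    refine Real.rpow_le_rpow_of_nonpos hx ht.1 ?_
    simp only [Complex.sub_re, Complex.neg_re, Complex.one_re]
    linarith

/-- The estimate that gains one power of |D|. The summand 1 in ‖s‖ + 1 pays for the kernel of D: if
μ = 0 ≠ ν, the difference has norm |ν|^(-Re s) = |ν| · |ν|^(-Re s - 1), with no factor ‖s‖. -/
lemma norm_nonzeroAbsPow_sub_le {s : ℂ} (hs : 0 ≤ s.re) (μ ν : ℝ) :
    ‖nonzeroAbsPow (-s) μ - nonzeroAbsPow (-s) ν‖ ≤ (‖s‖ + 1) * ‖((|μ| - |ν| : ℝ) : ℂ)‖ *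
      (‖nonzeroAbsPow (-s - 1) μ‖ + ‖nonzeroAbsPow (-s - 1) ν‖) := by
  wlog h : |μ| ≤ |ν| generalizing μ ν
  · have := this ν μ (le_of_not_ge h)
    rw [norm_sub_rev, add_comm ‖nonzeroAbsPow (-s - 1) μ‖]
    convert this using 3
    rw [Complex.norm_real, Complex.norm_real, norm_sub_rev]
  rcases eq_or_ne ν 0 with rfl | hν
  · have : μ = 0 := by simpa using h
    subst this
    simp [nonzeroAbsPow_zero]
  have hνp := abs_pos.mpr hν
  rw [Complex.norm_real, norm_sub_rev |μ|, Real.norm_of_nonneg (sub_nonneg.mpr h)]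
  rcases eq_or_ne μ 0 with rfl | hμ
  · rw [nonzeroAbsPow_zero, nonzeroAbsPow_zero, zero_sub, norm_neg, norm_zero, zero_add, abs_zero,
      sub_zero, norm_nonzeroAbsPow_of_ne hν, norm_nonzeroAbsPow_of_ne hν, mul_assoc,
      Complex.sub_re, Complex.one_re, Real.rpow_sub_one hνp.ne', mul_div_cancel₀ _ hνp.ne']
    exact le_mul_of_one_le_left (Real.rpow_nonneg hνp.le _) (by linarith [norm_nonneg s])
  · have hμp := abs_pos.mpr hμ
    rw [norm_nonzeroAbsPow_of_ne hν, norm_nonzeroAbsPow_of_ne hμ, nonzeroAbsPow_of_ne hμ,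
      nonzeroAbsPow_of_ne hν, norm_sub_rev]
    refine (norm_ofReal_cpow_neg_sub_le_of_le hs hμp h).trans ?_
    rw [mul_right_comm]
    have := Real.rpow_nonneg hνp.le (-s - 1).re
    have := Real.rpow_nonneg hμp.le (-s - 1).re
    have := sub_nonneg.mpr h
    gcongr <;> linarith

end NonzeroAbsPow

/-! ### Summability of |D|^w from the eigenvalue asymptotics -/

section Summability

variable {H : Type*} [NormedAddCommGroup H] [InnerProductSpace ℂ H]

lemma encard_le_toENat_rank {T : H →ₗ.[ℂ] H} {ι : Type*} {v : ι → H} (hv : Orthonormal ℂ v) {s : Set ι}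
    {ν : ℝ} (hs : ∀ i ∈ s, v i ∈ pmapEigenspace T ν) :
    s.encard ≤ Cardinal.toENat (Module.rank ℂ (pmapEigenspace T ν)) := by
  let u : s → pmapEigenspace T ν := fun i => ⟨v i, hs i i.2⟩
  have hu : LinearIndependent ℂ u := by
    refine LinearIndependent.of_comp (pmapEigenspace T ν).subtype ?_
    exact hv.linearIndependent.comp _ Subtype.val_injective
  have h := Cardinal.toENat.monotone' hu.cardinal_lift_le_rank
  simpa using h

variable [CompleteSpace H]
  {D : H →ₗ.[ℂ] H} {ι : Type*} {e : HilbertBasis ι ℂ H} {m : ι → ℝ}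

lemma absPow_eq_spectralFunction (D : H →ₗ.[ℂ] H) (w : ℂ) :
    absPow D w = spectralFunction D (nonzeroAbsPow w) := rfl

lemma mulAbsPow_eq_mul_diagOp (hD : IsSelfAdjoint D) (he : ∀ i, e i ∈ pmapEigenspace D (m i))
    {w : ℂ} (hw : Summable fun i => ‖nonzeroAbsPow w (m i)‖) (b : H →L[ℂ] H) :
    mulAbsPow D b w = b * diagOp e fun i => nonzeroAbsPow w (m i) := by
  rw [mulAbsPow, absPow_eq_spectralFunction, boundedExtension_spectralFunction hD he hw]

/-- If the `k`-th eigenvalue of `|D|⁻¹` is `O(k ^ (-1/n))`, then `|D| ^ w` is summable on an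
eigenbasis for `Re w < -n`. -/
lemma summable_norm_nonzeroAbsPow (hD : IsSelfAdjoint D) (he : ∀ i, e i ∈ pmapEigenspace D (m i))
    {lam : ℕ → ℝ} (hlam : IsEigenvalueSequence (absPow D (-1)) lam) {n : ℕ} (hn : 0 < n)
    (hO : lam =O[atTop] fun k : ℕ => (k : ℝ) ^ (-(1 : ℝ) / (n : ℝ))) {w : ℂ}
    (hw : w.re < -(n : ℝ)) : Summable fun i => ‖nonzeroAbsPow w (m i)‖ := by
  obtain ⟨-, hlam0, hcard⟩ := hlam
  have hn' : (0 : ℝ) < n := by exact_mod_cast hn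
  have hlim : Tendsto lam atTop (𝓝 0) := by
    refine hO.trans_tendsto ?_
    have := (tendsto_rpow_neg_atTop (y := 1 / (n : ℝ)) (by positivity)).comp
      tendsto_natCast_atTop_atTop
    simpa only [neg_div, Function.comp_def] using this
  have hfin : ∀ ν : ℝ, 0 < ν → {k | lam k = ν}.Finite := fun ν hν => by
    have h := (hlim.eventually_lt_const hν)
    rw [← Nat.cofinite_eq_atTop, Filter.eventually_cofinite] at h
    exact h.subset fun k hk => by simp only [Set.mem_ofPred_eq] at hk ⊢; linarith
  have hle : ∀ ν : ℝ, 0 < ν → {i | m i ≠ 0 ∧ |m i|⁻¹ = ν}.encard ≤ {k | lam k = ν}.encard := by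
    intro ν hν
    rw [hcard ν hν]
    refine encard_le_toENat_rank e.orthonormal ?_
    rintro i ⟨hi, rfl⟩
    refine ⟨mem_domain_spectralFunction_of_mem hD _ (he i), ?_⟩
    refine (spectralFunction_apply_of_mem hD (nonzeroAbsPow (-1)) (he i)).trans ?_
    rw [nonzeroAbsPow_of_ne hi, Complex.cpow_neg_one, Complex.ofReal_inv]
  -- For each value ν, the basis vectors with |m i|⁻¹ = ν inject into the indices k with `lam k` =
  -- ν, which are finitely many because `lam` tends to 0. Glued over all ν, these maps embed the
  -- nonzero part of the basis into ℕ compatibly with `lam`.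
  have hex : ∀ ν : ℝ, 0 < ν → ∃ g : ι → ℕ, {i | m i ≠ 0 ∧ |m i|⁻¹ = ν} ⊆ g ⁻¹' {k | lam k = ν} ∧
      Set.InjOn g {i | m i ≠ 0 ∧ |m i|⁻¹ = ν} := fun ν hν =>
    Set.Finite.exists_injOn_of_encard_le
      (Set.encard_lt_top_iff.mp ((hle ν hν).trans_lt (hfin ν hν).encard_lt_top)) (hle ν hν)
  choose! g hg hginj using hex
  have hpos : ∀ i, m i ≠ 0 → 0 < |m i|⁻¹ := fun i hi => inv_pos.mpr (abs_pos.mpr hi)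
  have hval : ∀ i, m i ≠ 0 → lam (g |m i|⁻¹ i) = |m i|⁻¹ := fun i hi =>
    hg _ (hpos i hi) ⟨hi, rfl⟩
  have hinj : Function.Injective fun i : {i | m i ≠ 0} => g |m i|⁻¹ i := by
    rintro ⟨i, hi⟩ ⟨j, hj⟩ hij
    have hij' : g |m i|⁻¹ i = g |m j|⁻¹ j := hij
    have h : |m i|⁻¹ = |m j|⁻¹ := by rw [← hval i hi, ← hval j hj, hij']
    rw [← h] at hij'
    exact Subtype.ext (hginj _ (hpos i hi) ⟨hi, rfl⟩ ⟨hj, h.symm⟩ hij')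
  -- The terms are O(k^(Re w / n)), and Re w / n < -1.
  have hsum : Summable fun k => lam k ^ (-w.re) := by
    have h := hO.rpow (r := -w.re) (by linarith)
      (Eventually.of_forall fun k => Real.rpow_nonneg (Nat.cast_nonneg k) _)
    refine summable_of_isBigO_nat ?_ h
    simp only [← Real.rpow_mul (Nat.cast_nonneg _)]
    rw [Real.summable_nat_rpow, div_mul_eq_mul_div, div_lt_iff₀ hn']
    linarith
  have hsub : Summable ((fun i => ‖nonzeroAbsPow w (m i)‖) ∘ ((↑) : {i | m i ≠ 0} → ι)) := by
    refine (hsum.comp_injective hinj).congr fun i => ?_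
    simp only [Function.comp_apply]
    rw [hval _ i.2, norm_nonzeroAbsPow_of_ne i.2, Real.inv_rpow (abs_nonneg _),
      Real.rpow_neg (abs_nonneg _), inv_inv]
  rw [summable_subtype_iff_indicator] at hsub
  refine hsub.congr fun i => ?_
  by_cases hi : m i = 0
  · simp [hi, nonzeroAbsPow_zero]
  · simp [hi]

end Summability

/-! ### The trace of A [B, |D|^(-s)] -/

section CommutatorTrace

variable {H : Type*} [NormedAddCommGroup H] [InnerProductSpace ℂ H] [CompleteSpace H]
  {ι : Type*} {e : HilbertBasis ι ℂ H} {m : ι → ℝ}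

/-- For fixed i, row i of X consists of coefficients of X* e_i and column i of Y of those of Y e_i,
so the sum over the second index is at most ‖X*‖ ‖Y‖. -/
lemma summable_weight_mul_matrix_entries (e : HilbertBasis ι ℂ H) {a : ι → ℝ} (ha : Summable a)
    (ha0 : ∀ i, 0 ≤ a i) (X Y : H →L[ℂ] H) :
    Summable fun p : ι × ι =>
      a p.1 * (‖inner ℂ (e p.1) (X (e p.2))‖ * ‖inner ℂ (e p.2) (Y (e p.1))‖) := by
  have h := summable_prod_norm_inner e.orthonormal ha ha0
    (fun i => ContinuousLinearMap.adjoint X (e i)) (fun i => Y (e i))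
    (C := ‖ContinuousLinearMap.adjoint X‖ * ‖Y‖) (fun i => by
      have h1 := (ContinuousLinearMap.adjoint X).le_opNorm (e i)
      have h2 := Y.le_opNorm (e i)
      rw [e.norm_eq_one, mul_one] at h1 h2
      gcongr)
  simpa only [ContinuousLinearMap.adjoint_inner_left] using h

lemma summable_weight_snd_mul_matrix_entries (e : HilbertBasis ι ℂ H) {a : ι → ℝ}
    (ha : Summable a) (ha0 : ∀ i, 0 ≤ a i) (X Y : H →L[ℂ] H) :
    Summable fun p : ι × ι =>
      a p.2 * (‖inner ℂ (e p.1) (X (e p.2))‖ * ‖inner ℂ (e p.2) (Y (e p.1))‖) := by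
  have h := (summable_weight_mul_matrix_entries e ha ha0 Y X).prod_symm
  refine h.congr fun p => ?_
  simp only [Prod.fst_swap, Prod.snd_swap]
  ring

lemma hasSum_weight_mul_matrix_entries (e : HilbertBasis ι ℂ H) {c : ι → ℂ}
    (hc : Summable fun i => ‖c i‖) (X Y : H →L[ℂ] H) :
    HasSum (fun p : ι × ι =>
      c p.1 * (inner ℂ (e p.1) (X (e p.2)) * inner ℂ (e p.2) (Y (e p.1))))
      (∑' i, c i * inner ℂ (e i) ((X * Y) (e i))) := by
  have hs : Summable fun p : ι × ι =>
      c p.1 * (inner ℂ (e p.1) (X (e p.2)) * inner ℂ (e p.2) (Y (e p.1))) := by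
    refine Summable.of_norm ?_
    simpa only [norm_mul] using
      summable_weight_mul_matrix_entries e hc (fun _ => norm_nonneg _) X Y
  have h : ∑' i, c i * inner ℂ (e i) ((X * Y) (e i)) = ∑' p : ι × ι,
      c p.1 * (inner ℂ (e p.1) (X (e p.2)) * inner ℂ (e p.2) (Y (e p.1))) := by
    rw [hs.tsum_prod]
    refine tsum_congr fun i => ?_
    simp only [← ContinuousLinearMap.adjoint_inner_left X]
    rw [tsum_mul_left, e.tsum_inner_mul_inner, ContinuousLinearMap.adjoint_inner_left]
    rfl
  rw [h]
  exact hs.hasSum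

/-- The trace `Tr (A [B, |D| ^ (-s)])`, as a sum over matrix entries. -/
def commutatorTrace (e : HilbertBasis ι ℂ H) (m : ι → ℝ) (A B : H →L[ℂ] H) (s : ℂ) : ℂ :=
  ∑' p : ι × ι, (nonzeroAbsPow (-s) (m p.1) - nonzeroAbsPow (-s) (m p.2)) *
    (inner ℂ (e p.1) (A (e p.2)) * inner ℂ (e p.2) (B (e p.1)))

lemma opTrace_mul_sub_opTrace_mul [Countable ι] (A B : H →L[ℂ] H) {s : ℂ}
    (hs : Summable fun i => ‖nonzeroAbsPow (-s) (m i)‖) :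
    opTrace (A * B * diagOp e fun i => nonzeroAbsPow (-s) (m i)) -
      opTrace (B * A * diagOp e fun i => nonzeroAbsPow (-s) (m i)) =
    commutatorTrace e m A B s := by
  rw [opTrace_mul_diagOp e hs, opTrace_mul_diagOp e hs]
  have h1 := hasSum_weight_mul_matrix_entries e hs A B
  -- Swapping the indices gives the second sum the same products A_ij B_ji as the first, with the
  -- weight now at j.
  have h2 := (Equiv.prodComm ι ι).hasSum_iff.mpr (hasSum_weight_mul_matrix_entries e hs B A)
  rw [← (h1.sub h2).tsum_eq]
  refine tsum_congr fun p => ?_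
  simp only [Function.comp_apply, Equiv.prodComm_apply, Prod.fst_swap, Prod.snd_swap]
  ring

/-- The trace `Tr (A [B, |D| ^ (-s)])` is holomorphic in a half-plane that is larger by one unit
than the half-plane of convergence of `Tr |D| ^ (-s)`, if `[|D|, B]` is bounded. -/
lemma differentiableOn_commutatorTrace {n : ℝ} (hn : 1 ≤ n)
    (hsum : ∀ w : ℂ, w.re < -n → Summable fun i => ‖nonzeroAbsPow w (m i)‖)
    (A : H →L[ℂ] H) {B S : H →L[ℂ] H}
    (hS : ∀ i j, inner ℂ (e j) (S (e i)) = ((|m j| - |m i| : ℝ) : ℂ) * inner ℂ (e j) (B (e i))) :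
    DifferentiableOn ℂ (commutatorTrace e m A B) {s | n - 1 < s.re} := by
  intro s₀ hs₀
  simp only [Set.mem_ofPred_eq] at hs₀
  -- The midpoint keeps a > n - 1, so that -a - 1 < -n is an exponent of summability, and a < Re s₀.
  set a : ℝ := (n - 1 + s₀.re) / 2 with ha
  set b : ℝ := s₀.re + 1 with hb
  set U : Set ℂ := {s | a < s.re} ∩ {s | s.re < b} ∩ Metric.ball 0 (‖s₀‖ + 1) with hU
  have hUo : IsOpen U := ((isOpen_lt continuous_const Complex.continuous_re).inter
    (isOpen_lt Complex.continuous_re continuous_const)).inter Metric.isOpen_ball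
  have hs₀U : s₀ ∈ U := ⟨⟨by simp only [Set.mem_ofPred_eq]; linarith,
    by simp only [Set.mem_ofPred_eq]; linarith⟩, by simp⟩
  let c : ι → ℝ := fun i => ‖nonzeroAbsPow ((-b - 1 : ℝ) : ℂ) (m i)‖ +
    ‖nonzeroAbsPow ((-a - 1 : ℝ) : ℂ) (m i)‖
  have hc0 : ∀ i, 0 ≤ c i := fun i => by positivity
  have hc : Summable c := (hsum _ (by rw [Complex.ofReal_re]; linarith)).add
    (hsum _ (by rw [Complex.ofReal_re]; linarith))
  -- On U one has ‖s‖ < ‖s₀‖ + 1, so ‖s₀‖ + 2 bounds the factor ‖s‖ + 1 of the power estimate.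
  let u : ι × ι → ℝ := fun p => (‖s₀‖ + 2) *
    (c p.1 * (‖inner ℂ (e p.1) (A (e p.2))‖ * ‖inner ℂ (e p.2) (S (e p.1))‖) +
      c p.2 * (‖inner ℂ (e p.1) (A (e p.2))‖ * ‖inner ℂ (e p.2) (S (e p.1))‖))
  have hu : Summable u := ((summable_weight_mul_matrix_entries e hc hc0 A S).add
    (summable_weight_snd_mul_matrix_entries e hc hc0 A S)).mul_left _
  have hdiff := Complex.differentiableOn_tsum_of_summable_norm
    (F := fun (p : ι × ι) (s : ℂ) =>
      (nonzeroAbsPow (-s) (m p.1) - nonzeroAbsPow (-s) (m p.2)) *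
        (inner ℂ (e p.1) (A (e p.2)) * inner ℂ (e p.2) (B (e p.1)))) hu
    (fun p => ?_) hUo ?_
  · exact ((hdiff s₀ hs₀U).differentiableAt (hUo.mem_nhds hs₀U)).differentiableWithinAt
  · have h : ∀ μ, Differentiable ℂ fun s : ℂ => nonzeroAbsPow (-s) μ := fun μ =>
      (differentiable_nonzeroAbsPow μ).comp differentiable_neg
    exact (((h _).sub (h _)).mul_const _).differentiableOn
  · rintro ⟨i, j⟩ s ⟨⟨hsa, hsb⟩, hsn⟩
    simp only [Set.mem_ofPred_eq, mem_ball_zero_iff] at hsa hsb hsn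
    have hw : ∀ k, ‖nonzeroAbsPow (-s - 1) (m k)‖ ≤ c k := fun k =>
      norm_nonzeroAbsPow_le_add
        (by simp only [Complex.ofReal_re, Complex.sub_re, Complex.neg_re, Complex.one_re]; linarith)
        (by simp only [Complex.ofReal_re, Complex.sub_re, Complex.neg_re, Complex.one_re]; linarith)
        (m k)
    have h1 := norm_nonzeroAbsPow_sub_le (s := s) (by linarith) (m i) (m j)
    -- The unbounded factor is absorbed: what remains is an entry of the bounded commutator S.
    have h2 : ‖((|m i| - |m j| : ℝ) : ℂ)‖ * ‖inner ℂ (e j) (B (e i))‖ =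
        ‖inner ℂ (e j) (S (e i))‖ := by
      rw [hS, norm_mul, Complex.norm_real, Complex.norm_real, norm_sub_rev]
    calc ‖(nonzeroAbsPow (-s) (m i) - nonzeroAbsPow (-s) (m j)) *
          (inner ℂ (e i) (A (e j)) * inner ℂ (e j) (B (e i)))‖
        ≤ ((‖s₀‖ + 2) * ‖((|m i| - |m j| : ℝ) : ℂ)‖ * (c i + c j)) *
          (‖inner ℂ (e i) (A (e j))‖ * ‖inner ℂ (e j) (B (e i))‖) := by
          rw [norm_mul, norm_mul (inner ℂ (e i) _)]
          refine mul_le_mul_of_nonneg_right (h1.trans ?_) (by positivity)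
          have := hc0 i
          have := hc0 j
          have := hw i
          have := hw j
          gcongr ?_ * _ * (?_ + ?_)
          linarith
      _ = u (i, j) := by
          simp only [u]
          rw [← h2]
          ring

end CommutatorTrace

/-! ### Residues of functions holomorphic off a closed discrete set -/

section ComplexAnalysis

/-- An open half-plane minus a countable set is connected. -/
lemma isPreconnected_halfPlane_diff_countable (a : ℝ) {S : Set ℂ} (hS : S.Countable) :
    IsPreconnected ({z : ℂ | a < z.re} \ S) := by
  -- A continuous bijection from ℂ onto the half-plane, which transports the connectedness of the
  -- complement of a countable set in the plane.
  let φ : ℂ → ℂ := fun w => ((a + Real.exp w.re : ℝ) : ℂ) + w.im * Complex.I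
  have hre : ∀ w, (φ w).re = a + Real.exp w.re := fun w => by
    simp [φ, -Complex.ofReal_exp]
  have him : ∀ w, (φ w).im = w.im := fun w => by simp [φ]
  have hφ : Continuous φ := by fun_prop
  have hinj : Function.Injective φ := fun v w h => by
    have h1 := congrArg Complex.re h
    have h2 := congrArg Complex.im h
    rw [hre, hre, add_right_inj] at h1
    rw [him, him] at h2
    exact Complex.ext (Real.exp_injective h1) h2
  have himage : φ '' (φ ⁻¹' S)ᶜ = {z : ℂ | a < z.re} \ S := by
    ext z
    constructor
    · rintro ⟨w, hw, rfl⟩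
      exact ⟨by simp only [Set.mem_ofPred_eq, hre]; linarith [Real.exp_pos w.re], hw⟩
    · rintro ⟨hz, hzS⟩
      simp only [Set.mem_ofPred_eq] at hz
      have hz' : φ (⟨Real.log (z.re - a), z.im⟩ : ℂ) = z := by
        refine Complex.ext ?_ (him _)
        rw [hre, Real.exp_log (sub_pos.mpr hz)]
        ring
      exact ⟨_, fun h => hzS (by rwa [Set.mem_preimage, hz'] at h), hz'⟩
  rw [← himage]
  exact ((hS.preimage hinj).isConnected_compl_of_one_lt_rank
    (by simp [Complex.rank_real_complex])).isPreconnected.image φ hφ.continuousOn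

lemma Set.countable_of_discreteTopology {X : Type*} [TopologicalSpace X]
    [SecondCountableTopology X] (S : Set X) [DiscreteTopology S] : S.Countable :=
  Set.countable_coe_iff.mp (TopologicalSpace.separableSpace_iff_countable.mp inferInstance)

/-- A closed discrete set does not meet small punctured discs. -/
lemma exists_closedBall_diff_subset_compl {S : Set ℂ} (hS : IsClosed S) [DiscreteTopology S]
    (c : ℂ) : ∃ R > 0, Metric.closedBall c R \ {c} ⊆ Sᶜ := by
  have h : Sᶜ ∈ 𝓝[≠] c := by
    by_cases hc : c ∈ S
    · rw [← disjoint_principal_right, disjoint_iff]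
      exact discreteTopology_subtype_iff.mp ‹_› c hc
    · exact mem_nhdsWithin_of_mem_nhds (hS.isOpen_compl.mem_nhds hc)
  obtain ⟨R, hR, h⟩ := (nhdsWithin_hasBasis Metric.nhds_basis_closedBall _).mem_iff.mp h
  exact ⟨R, hR, h⟩

/-- The integrals over small circles around `c` of a function that is holomorphic off a closed
discrete set do not depend on the radius. -/
lemma exists_eventually_circleIntegral_eq {S : Set ℂ} (hS : IsClosed S) [DiscreteTopology S]
    {F : ℂ → ℂ} (hF : DifferentiableOn ℂ F Sᶜ) (c : ℂ) :
    ∃ I : ℂ, ∀ᶠ r : ℝ in 𝓝[>] 0, (∮ z in C(c, r), F z) = I := by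
  obtain ⟨R, hR, hRS⟩ := exists_closedBall_diff_subset_compl hS c
  refine ⟨∮ z in C(c, R), F z, ?_⟩
  filter_upwards [Ioc_mem_nhdsGT hR] with r hr
  refine (Complex.circleIntegral_eq_of_differentiable_on_annulus_off_countable hr.1 hr.2
    Set.countable_empty (hF.continuousOn.mono ?_) fun z hz => ?_).symm
  · rintro z ⟨hz, hzr⟩
    refine hRS ⟨hz, ?_⟩
    rintro rfl
    exact hzr (Metric.mem_ball_self hr.1)
  · refine hF.differentiableAt (hS.isOpen_compl.mem_nhds
      (hRS ⟨Metric.ball_subset_closedBall hz.1.1, ?_⟩))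
    rintro rfl
    exact hz.1.2 (Metric.mem_closedBall_self hr.1.le)

/-- Two functions that are holomorphic off closed discrete sets, and whose difference extends
holomorphically from a right half-plane to a half-plane around `c`, have the same integrals over
small circles around `c`. -/
lemma eventually_circleIntegral_eq_of_sub_eq {S₁ S₂ : Set ℂ} (hS₁ : IsClosed S₁)
    (hS₂ : IsClosed S₂) [DiscreteTopology S₁] [DiscreteTopology S₂] {F₁ F₂ G p : ℂ → ℂ}
    (hF₁ : DifferentiableOn ℂ F₁ S₁ᶜ) (hF₂ : DifferentiableOn ℂ F₂ S₂ᶜ) {a x : ℝ} {c : ℂ}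
    (hac : a < c.re) (hG : DifferentiableOn ℂ G {z | a < z.re}) (hp : Differentiable ℂ p)
    (h : ∀ z : ℂ, x < z.re → F₁ z - F₂ z = G z) :
    ∀ᶠ r : ℝ in 𝓝[>] 0, (∮ z in C(c, r), p z * F₁ z) = ∮ z in C(c, r), p z * F₂ z := by
  set U : Set ℂ := {z | a < z.re} \ (S₁ ∪ S₂) with hU
  have hhalf : ∀ y : ℝ, IsOpen {z : ℂ | y < z.re} := fun y =>
    isOpen_lt continuous_const Complex.continuous_re
  have hUo : IsOpen U := (hhalf a).sdiff (hS₁.union hS₂)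
  have hcount : (S₁ ∪ S₂).Countable :=
    (Set.countable_of_discreteTopology S₁).union (Set.countable_of_discreteTopology S₂)
  have hUp : IsPreconnected U := isPreconnected_halfPlane_diff_countable a hcount
  have hd1 : DifferentiableOn ℂ (fun z => F₁ z - F₂ z) U :=
    (hF₁.mono fun z hz h => hz.2 (Or.inl h)).sub (hF₂.mono fun z hz h => hz.2 (Or.inr h))
  obtain ⟨z₀, hz₀, hz₀S⟩ : ∃ z₀ : ℂ, max a x < z₀.re ∧ z₀ ∉ S₁ ∪ S₂ := by
    obtain ⟨z₀, h₁, h₂⟩ := (hcount.dense_compl ℝ).inter_open_nonempty _ (hhalf (max a x))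
      ⟨((max a x + 1 : ℝ) : ℂ), by simp only [Set.mem_ofPred_eq, Complex.ofReal_re]; linarith⟩
    exact ⟨z₀, h₁, h₂⟩
  -- Identity theorem: U is connected and reaches both the region where the relation is given and
  -- every small circle around c.
  have hEq : Set.EqOn (fun z => F₁ z - F₂ z) G U := by
    refine (hd1.analyticOnNhd hUo).eqOn_of_preconnected_of_eventuallyEq
      ((hG.mono Set.sdiff_subset).analyticOnNhd hUo) hUp
      (z₀ := z₀) ⟨(le_max_left _ _).trans_lt hz₀, hz₀S⟩ ?_
    filter_upwards [(hhalf (max a x)).mem_nhds hz₀] with z hz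
    exact h z ((le_max_right _ _).trans_lt hz)
  obtain ⟨R₁, hR₁, h₁⟩ := exists_closedBall_diff_subset_compl hS₁ c
  obtain ⟨R₂, hR₂, h₂⟩ := exists_closedBall_diff_subset_compl hS₂ c
  obtain ⟨R₃, hR₃, h₃⟩ := Metric.nhds_basis_closedBall.mem_iff.mp ((hhalf a).mem_nhds hac)
  filter_upwards [Ioc_mem_nhdsGT hR₁, Ioc_mem_nhdsGT hR₂, Ioc_mem_nhdsGT hR₃] with r hr₁ hr₂ hr₃
  have hr : 0 < r := hr₁.1
  have hne : ∀ z ∈ Metric.sphere c r, z ∉ ({c} : Set ℂ) := by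
    rintro z hz rfl
    simp only [Metric.mem_sphere, dist_self] at hz
    exact hr.ne hz
  have hs₁ : ∀ z ∈ Metric.sphere c r, z ∈ S₁ᶜ := fun z hz => h₁
    ⟨Metric.closedBall_subset_closedBall hr₁.2 (Metric.sphere_subset_closedBall hz), hne z hz⟩
  have hs₂ : ∀ z ∈ Metric.sphere c r, z ∈ S₂ᶜ := fun z hz => h₂
    ⟨Metric.closedBall_subset_closedBall hr₂.2 (Metric.sphere_subset_closedBall hz), hne z hz⟩
  have hball : Metric.closedBall c r ⊆ {z | a < z.re} :=
    (Metric.closedBall_subset_closedBall hr₃.2).trans h₃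
  have hi₁ : CircleIntegrable (fun z => p z * F₁ z) c r :=
    (hp.continuous.continuousOn.mul (hF₁.continuousOn.mono hs₁)).circleIntegrable hr.le
  have hi₂ : CircleIntegrable (fun z => p z * F₂ z) c r :=
    (hp.continuous.continuousOn.mul (hF₂.continuousOn.mono hs₂)).circleIntegrable hr.le
  rw [← sub_eq_zero, ← circleIntegral.integral_sub hi₁ hi₂]
  have hcongr : (∮ z in C(c, r), p z * F₁ z - p z * F₂ z) = ∮ z in C(c, r), p z * G z := by
    refine circleIntegral.integral_congr hr.le fun z hz => ?_
    have hz' := hEq ⟨hball (Metric.sphere_subset_closedBall hz),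
      fun h => h.elim (hs₁ z hz) (hs₂ z hz)⟩
    simp only at hz' ⊢
    rw [← mul_sub, hz']
  have hpG : DifferentiableOn ℂ (fun z => p z * G z) {z | a < z.re} :=
    hp.differentiableOn.mul hG
  rw [hcongr]
  -- Cauchy's theorem: p G is holomorphic on the whole closed disc, its centre included.
  refine Complex.circleIntegral_eq_zero_of_differentiable_on_off_countable hr.le
    Set.countable_empty (hpG.continuousOn.mono hball) fun z hz => ?_
  exact hpG.differentiableAt
    ((hhalf a).mem_nhds (hball (Metric.ball_subset_closedBall hz.1)))

end ComplexAnalysis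

/-! ### Residues for spectral triples -/

namespace SpectralTriple

variable {A : Type*} [CStarAlgebra A] {H : Type*} [NormedAddCommGroup H]
  [InnerProductSpace ℂ H] [CompleteSpace H] [TopologicalSpace.SeparableSpace H]
  {T : SpectralTriple A H}

lemma generators_subset_algB {b : H →L[ℂ] H} (hb : b ∈ T.generators) : b ∈ T.algB :=
  Algebra.subset_adjoin ⟨b, hb, 0, rfl⟩

/-- An eigenbasis of `D`, with `|D| ^ w` summable for `Re w < -n` if the dimension is `n`. -/
lemma HasDimension.exists_eigenbasis {n : ℕ} (hT : T.HasDimension n) :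
    ∃ (ι : Type) (_ : Countable ι) (e : HilbertBasis ι ℂ H) (m : ι → ℝ),
      (∀ i, e i ∈ pmapEigenspace T.D (m i)) ∧
      ∀ w : ℂ, w.re < -(n : ℝ) → Summable fun i => ‖nonzeroAbsPow w (m i)‖ := by
  obtain ⟨ι, hι, e, m, he⟩ := exists_hilbertBasis_eigenvectors T.selfAdjoint T.compact_resolvent
  obtain ⟨hn, lam, hlam, hO⟩ := hT.1
  exact ⟨ι, hι, e, m, he, fun w hw =>
    summable_norm_nonzeroAbsPow T.selfAdjoint he hlam hn hO hw⟩

/-- The matrix entries of `[|D|, b]` in an eigenbasis of `D`. -/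
lemma inner_isCommutator_absOp {ι : Type*} {e : HilbertBasis ι ℂ H} {m : ι → ℝ}
    (he : ∀ i, e i ∈ pmapEigenspace T.D (m i)) {b S : H →L[ℂ] H}
    (hS : IsCommutator (absOp T.D) b S) (i j : ι) :
    inner ℂ (e j) (S (e i)) = ((|m j| - |m i| : ℝ) : ℂ) * inner ℂ (e j) (b (e i)) := by
  obtain ⟨h, hSi⟩ := hS ⟨e i, mem_domain_spectralFunction_of_mem T.selfAdjoint _ (he i)⟩
  have h1 := spectralFunction_apply_of_mem T.selfAdjoint (fun μ => ((|μ| : ℝ) : ℂ)) (he i)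
  have h2 := inner_spectralFunction_apply T.selfAdjoint (fun μ => ((|μ| : ℝ) : ℂ)) (he j)
    ⟨b (e i), h⟩
  have h3 : S (e i) = spectralFunction T.D (fun μ => ((|μ| : ℝ) : ℂ)) ⟨b (e i), h⟩ -
    b (spectralFunction T.D (fun μ => ((|μ| : ℝ) : ℂ)) ⟨e i, _⟩) := hSi.symm
  rw [h3, inner_sub_right, h1, h2, map_smul, inner_smul_right]
  push_cast
  ring

/-- Since Tr(b|D|^(-n-2z)) = ζ_b(z + n/2), the continuation of ζ_b and its singular set are
translated by n/2. The half-plane Re z > n/2 becomes Re z > 0. -/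
lemma HasDiscreteDimensionSpectrum.exists_hasTau {n : ℕ} (hdim : T.HasDimension n)
    (hspec : T.HasDiscreteDimensionSpectrum n) (k : ℕ) {b : H →L[ℂ] H} (hb : b ∈ T.algB) :
    ∃ c, T.HasTau k b (-(n : ℂ)) c := by
  obtain ⟨ι, hι, e, m, he, hsum⟩ := hdim.exists_eigenbasis
  obtain ⟨S, hS, hSd, hF⟩ := hspec
  obtain ⟨F, hF, hFz⟩ := hF b hb
  have hcont : Continuous fun z : ℂ => z + (n : ℂ) / 2 := by fun_prop
  set S' : Set ℂ := (fun z : ℂ => z + (n : ℂ) / 2) ⁻¹' S with hS'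
  have hS'c : IsClosed S' := hS.preimage hcont
  have hS'd : DiscreteTopology S' :=
    DiscreteTopology.preimage_of_continuous_injective S hcont (add_left_injective _)
  have hF' : DifferentiableOn ℂ (fun z => F (z + (n : ℂ) / 2)) S'ᶜ :=
    hF.comp (by fun_prop) fun z hz => hz
  obtain ⟨I, hI⟩ := exists_eventually_circleIntegral_eq hS'c
    (F := fun z => z ^ k * F (z + (n : ℂ) / 2)) ((by fun_prop : Differentiable ℂ
      fun z : ℂ => z ^ k).differentiableOn.mul hF') 0
  refine ⟨(2 * Real.pi * Complex.I : ℂ)⁻¹ * I, S', fun z => F (z + (n : ℂ) / 2), hS'c, hS'd, hF',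
    ⟨0, fun z hz => ⟨?_, ?_⟩⟩, hI.mono fun r hr => by rw [hr]⟩
  · have hw := hsum (-(n : ℂ) - 2 * z) (by simpa using hz)
    rw [mulAbsPow_eq_mul_diagOp T.selfAdjoint he hw]
    exact isTraceClass_mul_diagOp e hw b
  · have h := hFz (z + (n : ℂ) / 2) (by
      have : ((n : ℂ) / 2).re = (n : ℝ) / 2 := by
        rw [← Complex.ofReal_natCast, ← Complex.ofReal_ofNat, ← Complex.ofReal_div,
          Complex.ofReal_re]
      rw [Complex.add_re, this]
      linarith)
    simp only [h, zeta]
    congr 2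
    ring

/-- For bounded `A` and `B` with `[|D|, B]` bounded, `τ_k (A B |D| ^ (-n)) = τ_k (B A |D| ^ (-n))`
in dimension `n`. -/
lemma HasTau.mul_comm {n : ℕ} (hdim : T.HasDimension n) {k : ℕ} {A B S : H →L[ℂ] H}
    (hB : IsCommutator (absOp T.D) B S) {c₁ c₂ : ℂ} (h₁ : T.HasTau k (A * B) (-(n : ℂ)) c₁)
    (h₂ : T.HasTau k (B * A) (-(n : ℂ)) c₂) : c₁ = c₂ := by
  obtain ⟨ι, hι, e, m, he, hsum⟩ := hdim.exists_eigenbasis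
  obtain ⟨S₁, F₁, hS₁, hd₁, hF₁, ⟨x₁, hx₁⟩, hc₁⟩ := h₁
  obtain ⟨S₂, F₂, hS₂, hd₂, hF₂, ⟨x₂, hx₂⟩, hc₂⟩ := h₂
  have hn : (1 : ℝ) ≤ n := by exact_mod_cast hdim.1.1
  have hre : ∀ z : ℂ, ((n : ℂ) + 2 * z).re = n + 2 * z.re := fun z => by simp
  -- With s = n + 2z, the half-plane Re s > n - 1 becomes Re z > -1/2, which contains 0.
  have hG : DifferentiableOn ℂ (fun z => commutatorTrace e m A B ((n : ℂ) + 2 * z))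
      {z | -(1 / 2) < z.re} :=
    (differentiableOn_commutatorTrace hn hsum A
      (inner_isCommutator_absOp he hB)).comp (by fun_prop) fun z hz => by
        simp only [Set.mem_ofPred_eq] at hz ⊢
        rw [hre]
        linarith
  have hev := eventually_circleIntegral_eq_of_sub_eq hS₁ hS₂ hF₁ hF₂ (c := 0)
    (x := max 0 (max x₁ x₂)) (p := fun z => z ^ k) (by simp) hG (by fun_prop) fun z hz => by
      rw [max_lt_iff, max_lt_iff] at hz
      have hw := hsum (-((n : ℂ) + 2 * z)) (by rw [Complex.neg_re, hre]; linarith)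
      rw [(hx₁ z hz.2.1).2, (hx₂ z hz.2.2).2, ← opTrace_mul_sub_opTrace_mul A B hw,
        ← neg_add', mulAbsPow_eq_mul_diagOp T.selfAdjoint he hw,
        mulAbsPow_eq_mul_diagOp T.selfAdjoint he hw]
  -- One radius small enough for both residues and for the equality of the integrals.
  obtain ⟨r, h, h₁, h₂⟩ := (hev.and (hc₁.and hc₂)).exists
  rw [← h₁, ← h₂, h]

lemma hasTau_tau {k : ℕ} {b : H →L[ℂ] H} {y : ℂ} (h : ∃ c, T.HasTau k b y c) :
    T.HasTau k b y (T.tau k b y) := by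
  rw [tau, dif_pos h]
  exact h.choose_spec

end SpectralTriple

end

theorem lemma2p2 {A₀ : Type*} [CStarAlgebra A₀] {H : Type*} [NormedAddCommGroup H]
    [InnerProductSpace ℂ H] [CompleteSpace H] [TopologicalSpace.SeparableSpace H]
    (T : SpectralTriple A₀ H) (hdim : T.HasDimension 3) (hreg : T.IsRegular)
    (hspec : T.HasDiscreteDimensionSpectrum 3)
    (A B : H →L[ℂ] H) (hA : A ∈ T.generators) (hB : B ∈ T.generators) (k : ℕ) :
    T.HasTau k (A * B) (-3) (T.tau k (A * B) (-3)) ∧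
    T.HasTau k (B * A) (-3) (T.tau k (B * A) (-3)) ∧
    T.tau k (A * B) (-3) = T.tau k (B * A) (-3) := by
  have hA' := SpectralTriple.generators_subset_algB hA
  have hB' := SpectralTriple.generators_subset_algB hB
  have h₁ := SpectralTriple.hasTau_tau (hspec.exists_hasTau hdim k (mul_mem hA' hB'))
  have h₂ := SpectralTriple.hasTau_tau (hspec.exists_hasTau hdim k (mul_mem hB' hA'))
  -- A single application of δ to B suffices; S = [|D|, B].
  obtain ⟨S, R, rfl, hS⟩ := hreg B (Algebra.subset_adjoin hB) 1
  have h₃ := h₁.mul_comm hdim hS h₂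
  norm_num at h₁ h₂ h₃
  exact ⟨h₁, h₂, h₃⟩
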